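/- **Setting.** A parallel computer has $P\ge 1$ processors, each with a local memory of $W$ words (a word is one real number). A processor can perform scalar operations on words in its own memory, and it can exchange words with other processors by sending and receiving messages; a message consists of words in the memory of its sender and is received into the memory of its receiver. The words moved by a processor are the words it sends plus the words it receives, and its messages are the messages it sends plus the messages it receives. Let $m\ge n\ge 2$ with $n$ even. **Algorithms considered.** The entries of a real $m\times n$ matrix $A$ of rank $n$ are initially distributed over the local memories in any desired way (every entry being in some memory), and the algorithm computes a QR decomposition $A=QR$ ($Q$ an $m\times n$ matrix with orthonormal columns, $R$ upper triangular): at the end the entries of $R$ are stored, and parameters are stored from which $\bar Q=Q(1{:}m,1{:}\tfrac n2)$ is determined. Words may hold entries of a data structure $\tilde A_{jk}$ ($1\le j\le m$, $\tfrac n2<k\le n$), which stores $\bar A=A(1{:}m,\tfrac n2+1{:}n)$ and all that overwrites it, of a data structure $\tilde Q_{ji}$ of parameters representing $\bar Q$ (several parameters may belong to one position $(j,i)$), or partial or final results for $R_{ik}$; a word holds at most one such entry, except that a word holding $\tilde A_{jk}$ may at the same time be the location in which results for $R_{ik}$ are accumulated. The following is required. 1. For all $1\le i\le \tfrac n2<k\le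 n$ there are at least $m-i$ indices $j$ such that some processor, having both in its memory, multiplies a parameter belonging to $\tilde Q_{ji}$ by a value stored in $\tilde A_{jk}$, and stores or accumulates the product in a location for $R_{ik}$. 2. Computed entries are not just thrown away: if a processor brings an entry ($\tilde Q_{ji}$, $\tilde A_{jk}$ or a result for $R_{ik}$) into its memory by its own computation, then it keeps that entry (possibly with a changed value) in its memory to the end or sends it to another processor before it ceases to be in its memory. Nothing is required of entries that were in its memory initially or that it received. The operations performed may depend on $A$ (branches are allowed). **Theorem.** For every such algorithm and every real $m\times n$ input $A$ of rank $n$, at least one processor sends and receives $$\#\text{words}\ \ge\ \frac{\frac{mn^2}{4}-\frac{n^2}{8}\left(\frac n2+1\right)}{P(8W)^{1/2}}-W\ \ge\ \frac{3n^2\left(m-\frac43\right)}{16P(8W)^{1/2}}-W$$ words, using $$\#\text{messages}\ \ge\ \frac{\frac{mn^2}{4}-\frac{n^2}{8}\left(\frac n2+1\right)}{P(8W^3)^{1/2}}-1\ \ge\ \frac{3n^2\left(m-\frac43\right)}{16P(8W^3)^{1/2}}-1$$ messages. The same processor satisfies the following as well. If $W=mn/P$ and $n\ge 2^{11}m/P$,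 then $$\#\text{words}\ \ge\ \sqrt{\frac{mn^3}{2^{11}P}},\qquad \#\text{messages}\ \ge\ \sqrt{\frac{nP}{2^{11}m}} .$$ In particular, if $m=n$, $W=n^2/P$ and $P\ge 2^{11}$, then $$\#\text{words}\ \ge\ \frac{n^2}{2^{11/2}P^{1/2}},\qquad \#\text{messages}\ \ge\ \sqrt{\frac{P}{2^{11}}} .$$ -/

import Mathlib

namespace ParallelQR

/-! ### Words and the data structures they belong to

Everything is indexed from `0`: columns `i < n / 2` of an `m × n` matrix form its left half,
columns `n / 2 ≤ k` its right half. -/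

/-- The entries of the three data structures that are followed through a computation:
`q j i` is the `(j, i)` position of the representation of the left half of `Q`;
`a j k` is the `(j, k)` entry of the right half of the matrix and of everything overwriting it;
`r i k` is a partial or final result belonging to the entry `(i, k)` of `R`. -/
inductive Entry (m n : ℕ) where
  | q (j : Fin m) (i : Fin n)
  | a (j : Fin m) (k : Fin n)
  | r (i : Fin n) (k : Fin n)

/-- What a word is used for. A word holds at most one entry of one data structure, except that
(because of overwriting) the word holding `a j k` may at the same time be the location in which
results for `r i k` are accumulated. Several words may have the same role. -/
inductive Role (m n : ℕ) where
  | other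
  | q (j : Fin m) (i : Fin n)
  | a (j : Fin m) (k : Fin n)
  | r (i : Fin n) (k : Fin n)
  | ar (j : Fin m) (i : Fin n) (k : Fin n)

/-- The entries that a word with the given role holds. -/
def Role.entries {m n : ℕ} : Role m n → Set (Entry m n)
  | .other => ∅
  | .q j i => {.q j i}
  | .a j k => {.a j k}
  | .r i k => {.r i k}
  | .ar j i k => {.a j k, .r i k}

/-- A word: a real number, annotated with its role. -/
structure Word (m n : ℕ) where
  role : Role m n
  val : ℝ

/-! ### The parallel computer -/

/-- `P` local memories of `W` words each. -/
abbrev Memory (m n P W : ℕ) := Fin P → Fin W → Word m n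

/-- A message from `src` to `dst`. -/
structure Message (m n P : ℕ) where
  src : Fin P
  dst : Fin P
  body : List (Word m n)

/-- The local memories, and the messages that were sent but not yet received. -/
structure State (m n P W : ℕ) where
  mem : Memory m n P W
  net : Multiset (Message m n P)

/-- One step of the computer.
* `mul p g dst x y ρ`: processor `p` multiplies the words in its cells `x` and `y`, and stores the
  product in, or accumulates it into, its cell `dst` (the new value is `g old (x * y)`, for instance
  `x * y` or `old + x * y` or `old - x * y`); the new word gets role `ρ`.
* `op p f dst x y ρ`: any other scalar operation (addition, division, square root, copy, constant,
  comparison, ...) on words in the memory of `p`.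
* `send p q cells`: `p` sends to `q` one message, consisting of the words in the given cells.
* `recv p q cells`: `p` receives one message that `q` has sent to it into the given cells. -/
inductive Step (m n P W : ℕ) where
  | mul (p : Fin P) (g : ℝ → ℝ → ℝ) (dst x y : Fin W) (ρ : Role m n)
  | op (p : Fin P) (f : ℝ → ℝ → ℝ) (dst x y : Fin W) (ρ : Role m n)
  | send (p q : Fin P) (cells : List (Fin W))
  | recv (p q : Fin P) (cells : List (Fin W))

/-- Writing the word `w` into cell `c` of processor `p`. -/
def Memory.write {m n P W : ℕ} (M : Memory m n P W) (p : Fin P) (c : Fin W) (w : Word m n) :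
    Memory m n P W :=
  Function.update M p (Function.update (M p) c w)

/-- `Next s x s'`: the step `x` can be carried out in state `s` and leads to state `s'`. -/
def Next {m n P W : ℕ} (s : State m n P W) : Step m n P W → State m n P W → Prop
  | .mul p g dst x y ρ, s' =>
      s'.mem = s.mem.write p dst
        ⟨ρ, g (s.mem p dst).val ((s.mem p x).val * (s.mem p y).val)⟩ ∧
      s'.net = s.net
  | .op p f dst x y ρ, s' =>
      s'.mem = s.mem.write p dst ⟨ρ, f (s.mem p x).val (s.mem p y).val⟩ ∧
      s'.net = s.net
  | .send p q cells, s' =>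
      p ≠ q ∧ cells.Nodup ∧
      s'.mem = s.mem ∧
      s'.net = ⟨p, q, cells.map (s.mem p)⟩ ::ₘ s.net
  | .recv p q cells, s' =>
      cells.Nodup ∧
      s.net = ⟨q, p, cells.map (s'.mem p)⟩ ::ₘ s'.net ∧
      (∀ c, c ∉ cells → s'.mem p c = s.mem p c) ∧
      ∀ p', p' ≠ p → s'.mem p' = s.mem p'

/-- The number of words that processor `p` sends or receives in a step. -/
def Step.words {m n P W : ℕ} (p : Fin P) : Step m n P W → ℕ
  | .send p' _ cells => if p' = p then cells.length else 0
  | .recv p' _ cells => if p' = p then cells.length else 0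
  | _ => 0

/-- The number of messages that processor `p` sends or receives in a step. -/
def Step.messages {m n P W : ℕ} (p : Fin P) : Step m n P W → ℕ
  | .send p' _ _ => if p' = p then 1 else 0
  | .recv p' _ _ => if p' = p then 1 else 0
  | _ => 0

/-- The step is an arithmetic operation carried out by processor `p`. -/
def Step.IsLocal {m n P W : ℕ} (p : Fin P) : Step m n P W → Prop
  | .mul p' _ _ _ _ _ => p' = p
  | .op p' _ _ _ _ _ => p' = p
  | _ => False

/-- An execution: a finite sequence of steps; `state t` is the state after the first `t` steps. -/
structure Execution (m n P W : ℕ) where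
  steps : List (Step m n P W)
  state : ℕ → State m n P W
  valid : ∀ t x, steps[t]? = some x → Next (state t) x (state (t + 1))

namespace Execution

variable {m n P W : ℕ}

/-- The state at the end. -/
def final (E : Execution m n P W) : State m n P W := E.state E.steps.length

/-- The number of words sent and received by processor `p`. -/
def words (E : Execution m n P W) (p : Fin P) : ℕ := (E.steps.map (Step.words p)).sum

/-- The number of messages sent and received by processor `p`. -/
def messages (E : Execution m n P W) (p : Fin P) : ℕ := (E.steps.map (Step.messages p)).sum

/-- After `t` steps, the entry `e` is in the memory of processor `p`. -/
def Present (E : Execution m n P W) (p : Fin P) (e : Entry m n) (t : ℕ) : Prop :=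
  ∃ c, e ∈ ((E.state t).mem p c).role.entries

/-- Some processor multiplies a parameter belonging to position `(j, i)` of the representation of
`Q` by the value stored in entry `(j, k)` of the right half of the matrix, both in its memory, and
stores or accumulates the product in a location for `(i, k)`. -/
def Performs (E : Execution m n P W) (i : Fin n) (j : Fin m) (k : Fin n) : Prop :=
  ∃ t p g dst x y ρ, E.steps[t]? = some (.mul p g dst x y ρ) ∧
    Entry.r i k ∈ ρ.entries ∧
    ((Entry.q j i ∈ ((E.state t).mem p x).role.entries ∧
        Entry.a j k ∈ ((E.state t).mem p y).role.entries) ∨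
      (Entry.q j i ∈ ((E.state t).mem p y).role.entries ∧
        Entry.a j k ∈ ((E.state t).mem p x).role.entries))

/-- Step `t` is a message sent by processor `p` that contains a word holding the entry `e`. -/
def SendsAt (E : Execution m n P W) (p : Fin P) (e : Entry m n) (t : ℕ) : Prop :=
  ∃ q cells, E.steps[t]? = some (.send p q cells) ∧
    ∃ c ∈ cells, e ∈ ((E.state t).mem p c).role.entries

/-- Computed entries are not just thrown away: if a processor `p` brings the entry `e` into its
memory by a computation of its own (in step `s`), and `e` is later no longer in its memory (after
`u` steps), then `p` has sent it to another processor in between. No condition is put on entries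
that were in the memory from the beginning or arrived in a message. -/
def NothingThrownAway (E : Execution m n P W) : Prop :=
  ∀ (p : Fin P) (e : Entry m n) (s u : ℕ) (x : Step m n P W),
    E.steps[s]? = some x → x.IsLocal p →
    ¬ E.Present p e s → E.Present p e (s + 1) →
    s < u → u ≤ E.steps.length → ¬ E.Present p e u →
    ∃ t, s < t ∧ t < u ∧ E.SendsAt p e t

end Execution

/-! ### Algorithms -/

/-- The initial state for the input `A`, for a given distribution of its entries: a cell holds an
entry of `A` or is blank. The entries of the right half are marked as such. -/
def initialState {m n P W : ℕ} (layout : Fin P → Fin W → Option (Fin m × Fin n))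
    (A : Matrix (Fin m) (Fin n) ℝ) : State m n P W where
  mem p c :=
    match layout p c with
    | none => ⟨.other, 0⟩
    | some (j, k) => ⟨if n / 2 ≤ (k : ℕ) then .a j k else .other, A j k⟩
  net := 0

/-- The value and position of a word that belongs to the representation of `Q`. -/
def Word.qData {m n : ℕ} (w : Word m n) : Option (Fin m × Fin n × ℝ) :=
  match w.role with
  | .q j i => some (j, i, w.val)
  | _ => none

/-- An algorithm for `m × n` matrices on a computer with `P` processors with `W` words of memory
each: a distribution of the input, the execution on each input (which may depend on the input, so
that branches are allowed), the location of the entries of `R` at the end, and the way in which the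
stored parameters represent the left half of `Q`. -/
structure Algorithm (m n P W : ℕ) where
  layout : Fin P → Fin W → Option (Fin m × Fin n)
  run : Matrix (Fin m) (Fin n) ℝ → Execution m n P W
  run_init : ∀ A, (run A).state 0 = initialState layout A
  locR : Fin n → Fin n → Fin P × Fin W
  decodeQ : (Fin P → Fin W → Option (Fin m × Fin n × ℝ)) → Matrix (Fin m) (Fin n) ℝ

/-- `A = Q R` with orthonormal columns in `Q` and upper triangular `R`. -/
def IsQR {m n : ℕ} (A Q : Matrix (Fin m) (Fin n) ℝ) (R : Matrix (Fin n) (Fin n) ℝ) : Prop :=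
  A = Q * R ∧ Q.transpose * Q = 1 ∧ R.BlockTriangular id

/-- The class of QR algorithms considered; inputs are the matrices of full column rank. -/
structure Algorithm.IsQRAlgorithm {m n P W : ℕ} (alg : Algorithm m n P W) : Prop where
  /-- Each entry of the input is in some local memory at the beginning. -/
  input : ∀ (j : Fin m) (k : Fin n), ∃ p c, alg.layout p c = some (j, k)
  /-- The QR decomposition is computed: in the end `R` is stored, and the left half of `Q` is
  represented by the stored parameters. -/
  correct : ∀ A : Matrix (Fin m) (Fin n) ℝ, A.rank = n →
    ∃ Q R, IsQR A Q R ∧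
      (∀ i k, i ≤ k →
        ((alg.run A).final.mem (alg.locR i k).1 (alg.locR i k).2).val = R i k) ∧
      ∀ (j : Fin m) (i : Fin n), (i : ℕ) < n / 2 →
        alg.decodeQ (fun p c => ((alg.run A).final.mem p c).qData) j i = Q j i
  /-- The dependencies of matrix multiplication: for each entry `(i, k)` of the upper right block
  of `R` there are at least `m - i` rows `j` (`i` counted from `1`) for which the multiplication
  `(i, j, k)` is performed. -/
  products : ∀ A : Matrix (Fin m) (Fin n) ℝ, A.rank = n →
    ∀ i k : Fin n, (i : ℕ) < n / 2 → n / 2 ≤ (k : ℕ) →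
      ∃ J : Finset (Fin m), m - ((i : ℕ) + 1) ≤ J.card ∧ ∀ j ∈ J, (alg.run A).Performs i j k
  /-- Intermediate results are not just thrown away. -/
  kept : ∀ A : Matrix (Fin m) (Fin n) ℝ, A.rank = n → (alg.run A).NothingThrownAway

end ParallelQR

/-!
The steps of a processor are cut into segments in which about `W` words are sent or received. Any
entry that is in the memory at some moment of a segment is there at its beginning or at its end, or
it is sent or received within the segment: this is what `NothingThrownAway` gives
(`Execution.holds_slots_of_present`). So all entries met in a segment are held by `2 * W + L` words,
where `L` is the number of words moved.

The multiplications of a segment form a set of triples `(i, j, k)` whose projections are the entries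
`(j, i)` of `Q`, `(j, k)` of `A` and `(i, k)` of `R`, and the Loomis–Whitney inequality
(`card_sq_le_of_projections`) bounds the number `v` of triples by the numbers of these entries. A
word may hold an entry of `A` together with one of `R`, but an entry of `Q` occupies a word alone;
this yields `27 * v ^ 2 ≤ 4 * (2 * W + L) ^ 3` (`card_sq_le_of_holds`).

Cutting as soon as `L ≥ W`, one has `L ≤ 2 * W` since a message fits into a memory, and then
`v ≤ √(8 * W) * L`; the last segment, which may be incomplete, costs at most `√(8 * W) * W`. Summing
up, a processor with `v` multiplications moves at least `v / √(8 * W) - W` words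
(`Execution.card_mulsIn_le_words`). Some processor carries out at least the fraction `1 / P` of all
required multiplications (`Algorithm.IsQRAlgorithm.exists_card_mulsIn_ge`), which gives the bound on
the words; the bound on the messages follows by dividing by the largest possible message size `W`.
The remaining bounds are computations (`sqrt_le_of_memory_eq`).
-/

namespace ParallelQR

/-! ### The Loomis–Whitney inequality -/

/-- The discrete Loomis–Whitney inequality: a finite set of triples `(i, j, k)` is bounded by its
three coordinate projections. After the Cauchy–Schwarz inequality over the pairs `(i, k)`, the sum
of the squares of the fibre sizes counts the `(i, k, j, j')` with both `(i, j, k)` and `(i, j', k)`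
in the set, and such a quadruple is recovered from `(j, i)` and `(j', k)`. -/
theorem card_sq_le_of_projections {ι κ μ : Type*} [DecidableEq ι] [DecidableEq κ] [DecidableEq μ]
    (V : Finset (ι × κ × μ)) (Q : Finset (κ × ι)) (A : Finset (κ × μ)) (R : Finset (ι × μ))
    (hQ : ∀ v ∈ V, (v.2.1, v.1) ∈ Q) (hA : ∀ v ∈ V, (v.2.1, v.2.2) ∈ A)
    (hR : ∀ v ∈ V, (v.1, v.2.2) ∈ R) :
    V.card ^ 2 ≤ Q.card * A.card * R.card := by
  let fib : ι × μ → Finset (ι × κ × μ) := fun r => V.filter (fun v => (v.1, v.2.2) = r)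
  have h1 : V.card = ∑ r ∈ R, (fib r).card := Finset.card_eq_sum_card_fiberwise hR
  have h2 : V.card ^ 2 ≤ R.card * ∑ r ∈ R, (fib r).card ^ 2 := by
    rw [h1]; exact sq_sum_le_card_mul_sum_sq
  have h3 : ∑ r ∈ R, (fib r).card ^ 2 ≤ (Q ×ˢ A).card := by
    have : ∑ r ∈ R, (fib r).card ^ 2 = (R.sigma fun r => fib r ×ˢ fib r).card := by
      simp [Finset.card_sigma, sq]
    rw [this]
    refine Finset.card_le_card_of_injOn
      (fun x => ((x.2.1.2.1, x.2.1.1), (x.2.2.2.1, x.2.2.2.2))) ?_ ?_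
    · rintro ⟨r, v, w⟩ h
      simp only [Finset.coe_sigma, Set.mem_sigma_iff, Finset.mem_coe, Finset.mem_product,
        fib, Finset.mem_filter] at h
      exact Finset.mem_coe.2 (Finset.mem_product.2 ⟨hQ v h.2.1.1, hA w h.2.2.1⟩)
    · rintro ⟨r, ⟨i, j, k⟩, ⟨i', j', k'⟩⟩ h ⟨s, ⟨a, b, c⟩, ⟨a', b', c'⟩⟩ h' e
      simp only [Finset.coe_sigma, Set.mem_sigma_iff, Finset.mem_coe, Finset.mem_product,
        fib, Finset.mem_filter] at h h'
      obtain ⟨-, ⟨-, rfl⟩, -, h2⟩ := h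
      obtain ⟨-, ⟨-, rfl⟩, -, h4⟩ := h'
      simp only [Prod.mk.injEq] at h2 h4 e
      obtain ⟨rfl, rfl⟩ := h2
      obtain ⟨rfl, rfl⟩ := h4
      obtain ⟨⟨rfl, rfl⟩, rfl, rfl⟩ := e
      rfl
  rw [Finset.card_product] at h3
  calc V.card ^ 2 ≤ R.card * (Q.card * A.card) := h2.trans (Nat.mul_le_mul_left _ h3)
    _ = Q.card * A.card * R.card := by ring

/-! ### Entries held by a collection of words -/

/-- Some word of the collection `S` holds the entry `e`. -/
def Holds {m n : ℕ} (S : Multiset (Word m n)) (e : Entry m n) : Prop :=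
  ∃ w ∈ S, e ∈ w.role.entries

/-- If each word yields at most one element of `Q ⊔ B` and all these elements occur, there are at
least as many words as elements. -/
theorem card_add_card_le_card_of_filterMap {α β γ : Type*} [DecidableEq β] [DecidableEq γ]
    (S : Multiset α) (f : α → Option (β ⊕ γ)) (Q : Finset β) (B : Finset γ)
    (hQ : ∀ x ∈ Q, ∃ w ∈ S, f w = some (.inl x)) (hB : ∀ x ∈ B, ∃ w ∈ S, f w = some (.inr x)) :
    Q.card + B.card ≤ S.card := by
  rw [← Finset.card_disjSum]
  calc (Q.disjSum B).card ≤ (S.filterMap f).toFinset.card := by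
        refine Finset.card_le_card fun x hx => ?_
        rw [Multiset.mem_toFinset, Multiset.mem_filterMap]
        rcases Finset.mem_disjSum.1 hx with ⟨y, hy, rfl⟩ | ⟨y, hy, rfl⟩
        · exact hQ y hy
        · exact hB y hy
    _ ≤ (S.filterMap f).card := Multiset.toFinset_card_le _
    _ ≤ S.card := by
        induction S using Quotient.inductionOn with
        | h l => simpa using List.length_filterMap_le f l

/-- Triples all of whose entries are held by `N` words: since a word holding an entry of `Q` holds
nothing else, the numbers `q`, `a`, `r` of entries satisfy `q + a ≤ N` and `q + r ≤ N`, and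
`q * a * r` is at most `q * b ^ 2` with `q + b ≤ N`, which is largest for `b = 2 * q`. -/
theorem card_sq_le_of_holds {m n : ℕ} (S : Multiset (Word m n))
    (V : Finset (Fin n × Fin m × Fin n))
    (hq : ∀ v ∈ V, Holds S (.q v.2.1 v.1)) (ha : ∀ v ∈ V, Holds S (.a v.2.1 v.2.2))
    (hr : ∀ v ∈ V, Holds S (.r v.1 v.2.2)) :
    27 * V.card ^ 2 ≤ 4 * S.card ^ 3 := by
  classical
  let Q := V.image fun v => (v.2.1, v.1)
  let A := V.image fun v => (v.2.1, v.2.2)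
  let R := V.image fun v => (v.1, v.2.2)
  have hLW : V.card ^ 2 ≤ Q.card * A.card * R.card :=
    card_sq_le_of_projections V Q A R (fun _ h => Finset.mem_image_of_mem _ h)
      (fun _ h => Finset.mem_image_of_mem _ h) (fun _ h => Finset.mem_image_of_mem _ h)
  have hQA : Q.card + A.card ≤ S.card := by
    refine card_add_card_le_card_of_filterMap S (fun w => match w.role with
      | .q j i => some (.inl (j, i))
      | .a j k => some (.inr (j, k))
      | .ar j _ k => some (.inr (j, k))
      | _ => none) Q A (fun x hx => ?_) (fun x hx => ?_)
    · obtain ⟨v, hv, rfl⟩ := Finset.mem_image.1 hx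
      obtain ⟨w, hw, he⟩ := hq v hv
      refine ⟨w, hw, ?_⟩
      cases h : w.role <;> simp_all [Role.entries]
    · obtain ⟨v, hv, rfl⟩ := Finset.mem_image.1 hx
      obtain ⟨w, hw, he⟩ := ha v hv
      refine ⟨w, hw, ?_⟩
      cases h : w.role <;> simp_all [Role.entries]
  have hQR : Q.card + R.card ≤ S.card := by
    refine card_add_card_le_card_of_filterMap S (fun w => match w.role with
      | .q j i => some (.inl (j, i))
      | .r i k => some (.inr (i, k))
      | .ar _ i k => some (.inr (i, k))
      | _ => none) Q R (fun x hx => ?_) (fun x hx => ?_)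
    · obtain ⟨v, hv, rfl⟩ := Finset.mem_image.1 hx
      obtain ⟨w, hw, he⟩ := hq v hv
      refine ⟨w, hw, ?_⟩
      cases h : w.role <;> simp_all [Role.entries]
    · obtain ⟨v, hv, rfl⟩ := Finset.mem_image.1 hx
      obtain ⟨w, hw, he⟩ := hr v hv
      refine ⟨w, hw, ?_⟩
      cases h : w.role <;> simp_all [Role.entries]
  generalize Q.card = q at *
  generalize A.card = a at *
  generalize R.card = r at *
  generalize S.card = N at *
  obtain ⟨b, hb⟩ := Nat.exists_eq_add_of_le (show q ≤ N by omega)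
  have hab : a ≤ b := by omega
  have hrb : r ≤ b := by omega
  have h1 : 27 * V.card ^ 2 ≤ 27 * (q * b * b) :=
    Nat.mul_le_mul_left _ (hLW.trans (by gcongr))
  have h2 : 27 * (q * b * b) ≤ 4 * (q + b) ^ 3 := by
    zify
    have : (0 : ℤ) ≤ ((b : ℤ) - 2 * q) ^ 2 * (q + 4 * b) := by positivity
    linarith [show 4 * ((q : ℤ) + b) ^ 3 - 27 * (q * b * b) = ((b : ℤ) - 2 * q) ^ 2 * (q + 4 * b)
      by ring]
  rw [hb]; exact h1.trans h2

/-! ### The words available to a processor during a segment of an execution -/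

namespace Execution

variable {m n P W : ℕ}

/-- The words that processor `p` sends or receives in step `t`. -/
def moved (E : Execution m n P W) (p : Fin P) (t : ℕ) : Multiset (Word m n) :=
  match E.steps[t]? with
  | some (.send p' _ cells) => if p' = p then cells.map ((E.state t).mem p) else 0
  | some (.recv p' _ cells) => if p' = p then cells.map ((E.state (t + 1)).mem p) else 0
  | _ => 0

/-- The words in the memory of `p` after `s` steps, those after `u` steps, and those that `p` sends
or receives in between. -/
def slots (E : Execution m n P W) (p : Fin P) (s u : ℕ) : Multiset (Word m n) :=
  Finset.univ.val.map ((E.state s).mem p) + Finset.univ.val.map ((E.state u).mem p) +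
    ∑ t ∈ Finset.Ico s u, E.moved p t

theorem card_slots (E : Execution m n P W) (p : Fin P) (s u : ℕ) :
    (E.slots p s u).card = 2 * W + ∑ t ∈ Finset.Ico s u, (E.moved p t).card := by
  simp [slots, Multiset.card_sum]; ring

theorem holds_slots_of_present_left {E : Execution m n P W} {p : Fin P} {s u : ℕ} {e : Entry m n}
    (h : E.Present p e s) : Holds (E.slots p s u) e := by
  obtain ⟨c, hc⟩ := h
  exact ⟨_, by simp [slots], hc⟩

theorem holds_slots_of_present_right {E : Execution m n P W} {p : Fin P} {s u : ℕ} {e : Entry m n}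
    (h : E.Present p e u) : Holds (E.slots p s u) e := by
  obtain ⟨c, hc⟩ := h
  exact ⟨_, by simp [slots], hc⟩

theorem holds_slots_of_holds_moved {E : Execution m n P W} {p : Fin P} {s u t : ℕ} {e : Entry m n}
    (hs : s ≤ t) (hu : t < u) (h : Holds (E.moved p t) e) : Holds (E.slots p s u) e := by
  obtain ⟨w, hw, he⟩ := h
  refine ⟨w, Multiset.mem_add.2 (.inr ?_), he⟩
  exact Multiset.mem_sum.2 ⟨t, Finset.mem_Ico.2 ⟨hs, hu⟩, hw⟩

theorem holds_moved_of_sendsAt {E : Execution m n P W} {p : Fin P} {t : ℕ} {e : Entry m n}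
    (h : E.SendsAt p e t) : Holds (E.moved p t) e := by
  obtain ⟨q, cells, hst, c, hc, he⟩ := h
  refine ⟨_, ?_, he⟩
  simp only [moved, hst, if_true, Multiset.mem_coe, List.mem_map]
  exact ⟨c, hc, rfl⟩

/-- An entry can only appear in a memory by a computation or by a message. -/
theorem isLocal_or_holds_moved_of_present_succ {E : Execution m n P W} {p : Fin P} {t : ℕ}
    {x : Step m n P W} {e : Entry m n} (hx : E.steps[t]? = some x)
    (h0 : ¬ E.Present p e t) (h1 : E.Present p e (t + 1)) :
    x.IsLocal p ∨ Holds (E.moved p t) e := by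
  have hN := E.valid t x hx
  obtain ⟨c, hc⟩ := h1
  have hne : (E.state (t + 1)).mem p c ≠ (E.state t).mem p c := fun h => h0 ⟨c, h ▸ hc⟩
  cases x with
  | mul p' g dst x y ρ =>
    left
    by_contra hp
    refine hne ?_
    rw [hN.1, Memory.write, Function.update_of_ne (fun h => hp h.symm)]
  | op p' f dst x y ρ =>
    left
    by_contra hp
    refine hne ?_
    rw [hN.1, Memory.write, Function.update_of_ne (fun h => hp h.symm)]
  | send p' q cells => exact absurd (by rw [hN.2.2.1]) hne
  | recv p' q cells =>
    right
    obtain ⟨-, -, hcell, hproc⟩ := hN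
    have hp : p' = p := by
      by_contra hp
      exact hne (by rw [hproc p (fun h => hp h.symm)])
    subst hp
    refine ⟨_, ?_, hc⟩
    simp only [moved, hx, if_true, Multiset.mem_coe, List.mem_map]
    exact ⟨c, by_contra fun h => hne (hcell c h), rfl⟩

/-- An entry that is in the memory of `p` at some moment of a segment is held by a slot of that
segment: if it is neither there at the beginning nor received, it was computed, and then it is
still there at the end or was sent. -/
theorem holds_slots_of_present {E : Execution m n P W} (hE : E.NothingThrownAway) {p : Fin P}
    {s u : ℕ} (hu : u ≤ E.steps.length) {e : Entry m n} {t : ℕ} (hst : s ≤ t) (htu : t ≤ u)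
    (h : E.Present p e t) : Holds (E.slots p s u) e := by
  induction t, hst using Nat.le_induction with
  | base => exact holds_slots_of_present_left h
  | succ t hst ih =>
    by_cases h0 : E.Present p e t
    · exact ih (by omega) h0
    have hx : E.steps[t]? = some (E.steps[t]'(by omega)) := List.getElem?_eq_getElem (by omega)
    rcases isLocal_or_holds_moved_of_present_succ hx h0 h with hl | hm
    · by_cases hend : E.Present p e u
      · exact holds_slots_of_present_right hend
      obtain ⟨v, hv, hvu, hs⟩ := hE p e t u _ hx hl h0 h (by omega) hu hend
      exact holds_slots_of_holds_moved (by omega) hvu (holds_moved_of_sendsAt hs)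
    · exact holds_slots_of_holds_moved hst (by omega) hm

/-! ### Multiplications during a segment -/

/-- In step `t`, processor `p` carries out the multiplication belonging to the triple
`v = (i, j, k)`. -/
def MulAt (E : Execution m n P W) (p : Fin P) (v : Fin n × Fin m × Fin n) (t : ℕ) : Prop :=
  ∃ g dst x y ρ, E.steps[t]? = some (.mul p g dst x y ρ) ∧
    Entry.r v.1 v.2.2 ∈ ρ.entries ∧
    ((Entry.q v.2.1 v.1 ∈ ((E.state t).mem p x).role.entries ∧
        Entry.a v.2.1 v.2.2 ∈ ((E.state t).mem p y).role.entries) ∨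
      (Entry.q v.2.1 v.1 ∈ ((E.state t).mem p y).role.entries ∧
        Entry.a v.2.1 v.2.2 ∈ ((E.state t).mem p x).role.entries))

open Classical in
/-- The triples whose multiplication `p` carries out in one of the steps `s, …, u - 1`. -/
noncomputable def mulsIn (E : Execution m n P W) (p : Fin P) (s u : ℕ) :
    Finset (Fin n × Fin m × Fin n) :=
  Finset.univ.filter fun v => ∃ t, s ≤ t ∧ t < u ∧ E.MulAt p v t

theorem mem_mulsIn {E : Execution m n P W} {p : Fin P} {s u : ℕ} {v : Fin n × Fin m × Fin n} :
    v ∈ E.mulsIn p s u ↔ ∃ t, s ≤ t ∧ t < u ∧ E.MulAt p v t := by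
  simp [mulsIn]

theorem MulAt.present {E : Execution m n P W} {p : Fin P} {v : Fin n × Fin m × Fin n} {t : ℕ}
    (h : E.MulAt p v t) :
    E.Present p (.q v.2.1 v.1) t ∧ E.Present p (.a v.2.1 v.2.2) t ∧
      E.Present p (.r v.1 v.2.2) (t + 1) := by
  obtain ⟨g, dst, x, y, ρ, hst, hr, hqa⟩ := h
  have hN := E.valid t _ hst
  have hR : E.Present p (.r v.1 v.2.2) (t + 1) := by
    refine ⟨dst, ?_⟩
    rw [hN.1, Memory.write, Function.update_self, Function.update_self]
    exact hr
  rcases hqa with ⟨hq, ha⟩ | ⟨hq, ha⟩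
  · exact ⟨⟨x, hq⟩, ⟨y, ha⟩, hR⟩
  · exact ⟨⟨y, hq⟩, ⟨x, ha⟩, hR⟩

/-- The multiplications of a segment, bounded in terms of the number `2 * W + L` of its slots. -/
theorem card_mulsIn_sq_le {E : Execution m n P W} (hE : E.NothingThrownAway) (p : Fin P)
    {s u : ℕ} (hu : u ≤ E.steps.length) :
    27 * (E.mulsIn p s u).card ^ 2 ≤
      4 * (2 * W + ∑ t ∈ Finset.Ico s u, (E.moved p t).card) ^ 3 := by
  rw [← card_slots]
  have key : ∀ v ∈ E.mulsIn p s u, Holds (E.slots p s u) (.q v.2.1 v.1) ∧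
      Holds (E.slots p s u) (.a v.2.1 v.2.2) ∧ Holds (E.slots p s u) (.r v.1 v.2.2) := by
    intro v hv
    obtain ⟨t, hst, htu, hm⟩ := mem_mulsIn.1 hv
    obtain ⟨hq, ha, hr⟩ := hm.present
    exact ⟨holds_slots_of_present hE hu hst htu.le hq, holds_slots_of_present hE hu hst htu.le ha,
      holds_slots_of_present hE hu (by omega) htu hr⟩
  exact card_sq_le_of_holds _ _ (fun v hv => (key v hv).1) (fun v hv => (key v hv).2.1)
    (fun v hv => (key v hv).2.2)

theorem card_mulsIn_le_add (E : Execution m n P W) (p : Fin P) (s t u : ℕ) :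
    (E.mulsIn p s u).card ≤ (E.mulsIn p s t).card + (E.mulsIn p t u).card := by
  classical
  refine (Finset.card_le_card (t := E.mulsIn p s t ∪ E.mulsIn p t u) fun v hv => ?_).trans
    (Finset.card_union_le _ _)
  obtain ⟨a, hs, hu, hm⟩ := mem_mulsIn.1 hv
  rcases lt_or_ge a t with h | h
  · exact Finset.mem_union_left _ (mem_mulsIn.2 ⟨a, hs, h, hm⟩)
  · exact Finset.mem_union_right _ (mem_mulsIn.2 ⟨a, h, hu, hm⟩)

/-! ### From segments to the whole execution -/

theorem _root_.List.sum_map_eq_sum_range_getElem? {α : Type*} (l : List α) (f : α → ℕ) :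
    (l.map f).sum = ∑ t ∈ Finset.range l.length, (l[t]?.map f).getD 0 := by
  induction l with
  | nil => simp
  | cons a l ih => simp [Finset.sum_range_succ', ih, add_comm]

theorem words_eq_sum_card_moved (E : Execution m n P W) (p : Fin P) :
    E.words p = ∑ t ∈ Finset.range E.steps.length, (E.moved p t).card := by
  rw [words, List.sum_map_eq_sum_range_getElem?]
  refine Finset.sum_congr rfl fun t _ => ?_
  unfold moved
  rcases E.steps[t]? with _ | x
  · rfl
  · cases x <;> simp only [Option.map_some, Option.getD_some, Step.words] <;>
      first | rfl | (split_ifs <;> simp)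

theorem length_le_of_nodup {l : List (Fin W)} (hl : l.Nodup) : l.length ≤ W := by
  simpa using hl.length_le_card

/-- A message fits into a local memory. -/
theorem words_le_mul_messages_of_next {s s' : State m n P W} {x : Step m n P W} (h : Next s x s')
    (p : Fin P) : x.words p ≤ W * x.messages p := by
  cases x with
  | mul => simp [Step.words]
  | op => simp [Step.words]
  | send p' q cells =>
    simp only [Step.words, Step.messages]
    split_ifs <;> simp [length_le_of_nodup h.2.1]
  | recv p' q cells =>
    simp only [Step.words, Step.messages]
    split_ifs <;> simp [length_le_of_nodup h.1]

theorem words_le_mul_messages (E : Execution m n P W) (p : Fin P) :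
    E.words p ≤ W * E.messages p := by
  rw [words, messages, ← List.sum_map_mul_left]
  refine List.sum_le_sum fun x hx => ?_
  obtain ⟨t, ht⟩ := List.mem_iff_getElem?.1 hx
  exact words_le_mul_messages_of_next (E.valid t x ht) p

theorem card_moved_le (E : Execution m n P W) (p : Fin P) (t : ℕ) : (E.moved p t).card ≤ W := by
  unfold moved
  split
  · next h =>
    split_ifs
    · simpa using length_le_of_nodup (E.valid _ _ h).2.1
    · simp
  · next h =>
    split_ifs
    · simpa using length_le_of_nodup (E.valid _ _ h).1
    · simp
  · simp

/-- The remaining execution from step `s` on is cut at the first moment `u` at which at least `W`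
words have been moved. As a message has at most `W` words, the number `L` of words moved until `u`
satisfies `W ≤ L ≤ 2 * W`, so that the segment has at most `√(8 * W) * L` multiplications. The last
segment, with at most `W` words moved, has at most `√(8 * W) * W`. -/
theorem card_mulsIn_le {E : Execution m n P W} (hE : E.NothingThrownAway) (p : Fin P) (s : ℕ)
    (hs : s ≤ E.steps.length) :
    ((E.mulsIn p s E.steps.length).card : ℝ) ≤
      √(8 * W) * (((∑ t ∈ Finset.Ico s E.steps.length, (E.moved p t).card : ℕ) : ℝ) + W) := by
  induction h : E.steps.length - s using Nat.strong_induction_on generalizing s with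
  | _ d ih =>
  by_cases hex : ∃ u, s < u ∧ u ≤ E.steps.length ∧ W ≤ ∑ t ∈ Finset.Ico s u, (E.moved p t).card
  · classical
    obtain ⟨hsu, hu, hW⟩ := Nat.find_spec hex
    have hmin := fun v => Nat.find_min (m := v) hex
    generalize Nat.find hex = u at *
    have hrec := ih (E.steps.length - u) (by omega) u hu rfl
    have hsplit := Finset.sum_Ico_consecutive (fun t => (E.moved p t).card) hsu.le hu
    have hL : ∑ t ∈ Finset.Ico s u, (E.moved p t).card ≤ 2 * W := by
      obtain ⟨v, rfl⟩ : ∃ v, u = v + 1 := ⟨u - 1, by omega⟩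
      rw [Finset.sum_Ico_succ_top (by omega)]
      have h1 := E.card_moved_le p v
      rcases Nat.lt_or_ge s v with hsv | hsv
      · have := hmin v (by omega)
        push Not at this
        have := this hsv (by omega)
        omega
      · rw [Finset.Ico_eq_empty (by omega), Finset.sum_empty]; omega
    have hseg := card_mulsIn_sq_le hE p (s := s) hu
    have hadd := E.card_mulsIn_le_add p s u E.steps.length
    rw [← hsplit]
    generalize ∑ t ∈ Finset.Ico s u, (E.moved p t).card = L at *
    have hseg' : ((E.mulsIn p s u).card : ℝ) ≤ √(8 * W) * L := by
      have h2 : (E.mulsIn p s u).card ^ 2 ≤ 8 * W * L ^ 2 := by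
        have h3 : (2 * W + L) ^ 3 ≤ (3 * L) ^ 3 := Nat.pow_le_pow_left (by omega) 3
        have h4 : L ^ 2 * L ≤ L ^ 2 * (2 * W) := Nat.mul_le_mul_left _ hL
        nlinarith
      refine le_of_sq_le_sq ?_ (by positivity)
      rw [mul_pow, Real.sq_sqrt (by positivity)]
      exact_mod_cast h2
    have hadd' : ((E.mulsIn p s E.steps.length).card : ℝ) ≤
      (E.mulsIn p s u).card + (E.mulsIn p u E.steps.length).card := by exact_mod_cast hadd
    push_cast at hrec ⊢
    nlinarith
  · have hL : ∑ t ∈ Finset.Ico s E.steps.length, (E.moved p t).card ≤ W := by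
      by_contra hlt
      push Not at hlt
      rcases hs.lt_or_eq with h' | h'
      · exact hex ⟨_, h', le_rfl, hlt.le⟩
      · simp [h'] at hlt
    have hseg := card_mulsIn_sq_le hE p (s := s) le_rfl
    have h2 : (E.mulsIn p s E.steps.length).card ^ 2 ≤ 8 * W * W ^ 2 := by
      have h3 : (2 * W + ∑ t ∈ Finset.Ico s E.steps.length, (E.moved p t).card) ^ 3 ≤
        (3 * W) ^ 3 := Nat.pow_le_pow_left (by omega) 3
      nlinarith
    have h3 : ((E.mulsIn p s E.steps.length).card : ℝ) ≤ √(8 * W) * W := by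
      refine le_of_sq_le_sq ?_ (by positivity)
      rw [mul_pow, Real.sq_sqrt (by positivity)]
      exact_mod_cast h2
    refine h3.trans (mul_le_mul_of_nonneg_left ?_ (by positivity))
    exact le_add_of_nonneg_left (by positivity)

/-- The number of multiplications of a processor bounds the number of words it moves. -/
theorem card_mulsIn_le_words {E : Execution m n P W} (hE : E.NothingThrownAway) (p : Fin P) :
    ((E.mulsIn p 0 E.steps.length).card : ℝ) ≤ √(8 * W) * (E.words p + W) := by
  have := card_mulsIn_le hE p 0 (Nat.zero_le _)
  rwa [← Finset.range_eq_Ico, ← words_eq_sum_card_moved] at this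

theorem exists_mem_mulsIn_of_performs {E : Execution m n P W} {i : Fin n} {j : Fin m} {k : Fin n}
    (h : E.Performs i j k) : ∃ p, (i, j, k) ∈ E.mulsIn p 0 E.steps.length := by
  obtain ⟨t, p, g, dst, x, y, ρ, hst, hr, hqa⟩ := h
  refine ⟨p, mem_mulsIn.2 ⟨t, Nat.zero_le _, ?_, ?_⟩⟩
  · exact (List.getElem?_eq_some_iff.1 hst).1
  · exact ⟨g, dst, x, y, ρ, hst, hr, hqa⟩

end Execution

/-! ### Counting the required multiplications -/

/-- The number of triples `(i, j, k)` required for `n = 2 * h`. -/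
theorem sum_required_products (m h : ℕ) (hm : h ≤ m) :
    ((∑ i : Fin (2 * h), ∑ k : Fin (2 * h),
      if (i : ℕ) < h ∧ h ≤ (k : ℕ) then m - ((i : ℕ) + 1) else 0 : ℕ) : ℝ) =
      (h : ℝ) * (m * h - h * (h + 1) / 2) := by
  have hin : ∀ c : ℕ, ∑ k ∈ Finset.range (2 * h), (if h ≤ k then c else 0) = h * c := by
    intro c
    rw [two_mul, Finset.sum_range_add, Finset.sum_eq_zero (fun k hk => if_neg (by simpa using hk))]
    simp
  have hout : ∀ l ≤ h,
      ((∑ i ∈ Finset.range l, (m - (i + 1)) : ℕ) : ℝ) = m * l - l * (l + 1) / 2 := by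
    intro l
    induction l with
    | zero => simp
    | succ l ih =>
      intro hl
      rw [Finset.sum_range_succ, Nat.cast_add, ih (by omega), Nat.cast_sub (by omega)]
      push_cast; ring
  have heq : (∑ i : Fin (2 * h), ∑ k : Fin (2 * h),
      if (i : ℕ) < h ∧ h ≤ (k : ℕ) then m - ((i : ℕ) + 1) else 0) =
      h * ∑ i ∈ Finset.range h, (m - (i + 1)) := by
    have h1 : ∀ i : ℕ, (∑ k : Fin (2 * h), if i < h ∧ h ≤ (k : ℕ) then m - (i + 1) else 0) =
        if i < h then h * (m - (i + 1)) else 0 := by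
      intro i
      rw [Fin.sum_univ_eq_sum_range (fun k => if i < h ∧ h ≤ k then m - (i + 1) else 0)]
      by_cases hi : i < h
      · simp only [hi, true_and, if_true, hin]
      · simp [hi]
    simp only [h1]
    rw [Fin.sum_univ_eq_sum_range (fun i => if i < h then h * (m - (i + 1)) else 0), two_mul,
      Finset.sum_range_add, Finset.mul_sum,
      Finset.sum_congr rfl (fun i hi => if_pos (Finset.mem_range.1 hi))]
    simp
  rw [heq, Nat.cast_mul, hout h le_rfl]

/-- Some processor carries out at least its share of the multiplications. -/
theorem Algorithm.IsQRAlgorithm.exists_card_mulsIn_ge {m n P W : ℕ} (hn : Even n) (hmn : n ≤ m)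
    (hP : 0 < P) {alg : Algorithm m n P W} (halg : alg.IsQRAlgorithm)
    {A : Matrix (Fin m) (Fin n) ℝ} (hA : A.rank = n) :
    ∃ p : Fin P, (m : ℝ) * n ^ 2 / 4 - (n : ℝ) ^ 2 / 8 * ((n : ℝ) / 2 + 1) ≤
      P * (((alg.run A).mulsIn p 0 (alg.run A).steps.length).card : ℝ) := by
  classical
  obtain ⟨h, rfl⟩ := hn.two_dvd
  have hh : 2 * h / 2 = h := by omega
  have hprod := halg.products A hA
  rw [hh] at hprod
  choose! J hJ hJP using hprod
  set E := alg.run A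
  let M : Fin P → Finset (Fin (2 * h) × Fin m × Fin (2 * h)) :=
    fun p => E.mulsIn p 0 E.steps.length
  let T : Finset ((_ : Fin (2 * h) × Fin (2 * h)) × Fin m) :=
    (Finset.univ.filter fun ik : Fin (2 * h) × Fin (2 * h) => (ik.1 : ℕ) < h ∧ h ≤ (ik.2 : ℕ)).sigma
      fun ik => J ik.1 ik.2
  have hT : (∑ i : Fin (2 * h), ∑ k : Fin (2 * h),
      if (i : ℕ) < h ∧ h ≤ (k : ℕ) then m - ((i : ℕ) + 1) else 0) ≤ T.card := by
    rw [Finset.card_sigma, Finset.sum_filter, ← Finset.univ_product_univ, Finset.sum_product]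
    refine Finset.sum_le_sum fun i _ => Finset.sum_le_sum fun k _ => ?_
    split_ifs with hik
    · exact hJ i k hik.1 hik.2
    · exact le_rfl
  have hTM : T.card ≤ (Finset.univ.biUnion M).card := by
    refine Finset.card_le_card_of_injOn (fun x => (x.1.1, x.2, x.1.2)) ?_ ?_
    · rintro ⟨⟨i, k⟩, j⟩ hx
      simp only [T, Finset.coe_sigma, Set.mem_sigma_iff, Finset.mem_coe, Finset.mem_filter,
        Finset.mem_univ, true_and] at hx
      obtain ⟨p, hp⟩ := Execution.exists_mem_mulsIn_of_performs (hJP i k hx.1.1 hx.1.2 j hx.2)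
      exact Finset.mem_coe.2 (Finset.mem_biUnion.2 ⟨p, Finset.mem_univ _, hp⟩)
    · rintro ⟨⟨i, k⟩, j⟩ - ⟨⟨i', k'⟩, j'⟩ - e
      simp only [Prod.mk.injEq] at e
      obtain ⟨rfl, rfl, rfl⟩ := e
      rfl
  have : Nonempty (Fin P) := ⟨⟨0, hP⟩⟩
  obtain ⟨p, -, hp⟩ := Finset.exists_max_image Finset.univ (fun p => (M p).card)
    Finset.univ_nonempty
  have hsum : (Finset.univ.biUnion M).card ≤ P * (M p).card := by
    refine Finset.card_biUnion_le.trans ?_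
    simpa using Finset.sum_le_card_nsmul Finset.univ (fun p => (M p).card) _ hp
  refine ⟨p, ?_⟩
  have hfin := (Nat.cast_le (α := ℝ)).2 (hT.trans (hTM.trans hsum))
  rw [sum_required_products m h (by omega), Nat.cast_mul] at hfin
  refine le_trans (le_of_eq ?_) hfin
  push_cast; ring

/-! ### Consequences for memories of size `m n / P` -/

/-- With `W = m n / P` words of memory let `S = √(m n³ / (2 ^ 11 P))`. The first term of the general
bound on the words is at least `2 * S` and the subtracted `W` at most `S` if `n P ≥ 2 ^ 11 m`. The
second claim is the first one again, as `S = √(n P / (2 ^ 11 m)) * W`; it is the form that bounds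
the number of messages. -/
theorem sqrt_le_of_memory_eq {m n P W : ℕ} (hn0 : 0 < n) (hmn : n ≤ m) (hP : 0 < P) (hW : 0 < W)
    (hWeq : (W : ℝ) = (m : ℝ) * n / P) (hnP : (2 : ℝ) ^ 11 * m / P ≤ n) {w : ℝ}
    (hw : ((m : ℝ) * n ^ 2 / 4 - (n : ℝ) ^ 2 / 8 * ((n : ℝ) / 2 + 1)) / (P * √(8 * (W : ℝ))) - W
      ≤ w) :
    √((m : ℝ) * n ^ 3 / (2 ^ 11 * P)) ≤ w ∧ √((n : ℝ) * P / (2 ^ 11 * m)) * W ≤ w := by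
  have hn' : (0 : ℝ) < n := by exact_mod_cast hn0
  have hm' : (0 : ℝ) < m := by exact_mod_cast hn0.trans_le hmn
  have hP' : (0 : ℝ) < P := by exact_mod_cast hP
  have hW' : (1 : ℝ) ≤ W := by exact_mod_cast hW
  have hmn' : (n : ℝ) ≤ m := by exact_mod_cast hmn
  have hWP : (W : ℝ) * P = m * n := by rw [hWeq]; field_simp
  have hnP' : (2 : ℝ) ^ 11 * m ≤ n * P := by rwa [div_le_iff₀ hP'] at hnP
  -- the memory holds at least one word, which excludes small matrices
  have hn32 : (32 : ℝ) ≤ n := by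
    by_contra hlt
    push Not at hlt
    have h1 : (P : ℝ) ≤ m * n := by nlinarith
    have h2 : (2 : ℝ) ^ 11 * m ≤ n * n * m := by nlinarith
    have h3 : (2 : ℝ) ^ 11 ≤ n * n := le_of_mul_le_mul_right h2 hm'
    nlinarith
  set S := √((m : ℝ) * n ^ 3 / (2 ^ 11 * P)) with hS
  have hS2 : S ^ 2 = (W : ℝ) * n ^ 2 / 2 ^ 11 := by
    rw [hS, Real.sq_sqrt (by positivity), hWeq]; field_simp
  have hS0 : 0 ≤ S := Real.sqrt_nonneg _
  have heq : √((n : ℝ) * P / (2 ^ 11 * m)) * W = S := by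
    rw [← abs_of_nonneg (show (0 : ℝ) ≤ W by positivity), ← Real.sqrt_sq_eq_abs,
      ← Real.sqrt_mul (by positivity), hS, hWeq]
    congr 1
    field_simp
  rw [heq, and_self]
  refine le_trans ?_ hw
  set D := √(8 * (W : ℝ)) with hD
  have hD2 : D ^ 2 = 8 * W := Real.sq_sqrt (by positivity)
  have hDpos : 0 < D := Real.sqrt_pos.2 (by positivity)
  have hWS : (W : ℝ) ≤ S := by
    refine le_of_sq_le_sq ?_ hS0
    rw [hS2, le_div_iff₀ (by positivity)]
    have h1 : (2 : ℝ) ^ 11 * W * P ≤ n ^ 2 * P := by nlinarith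
    have h2 : (2 : ℝ) ^ 11 * W ≤ n ^ 2 := le_of_mul_le_mul_right h1 hP'
    nlinarith
  have hSD : S * D = W * n / 16 := by
    refine (sq_eq_sq₀ (by positivity) (by positivity)).1 ?_
    rw [mul_pow, hS2, hD2]; ring
  have hmain : 2 * S ≤
      ((m : ℝ) * n ^ 2 / 4 - (n : ℝ) ^ 2 / 8 * ((n : ℝ) / 2 + 1)) / (P * D) := by
    rw [le_div_iff₀ (by positivity)]
    have h1 : 2 * S * (P * D) = m * n ^ 2 / 8 := by
      calc 2 * S * (P * D) = 2 * P * (S * D) := by ring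
        _ = (W * P) * n / 8 := by rw [hSD]; ring
        _ = m * n ^ 2 / 8 := by rw [hWP]; ring
    rw [h1]
    have : 0 ≤ (n : ℝ) ^ 2 * (m / 16 - 1 / 8 + (m - n) / 16) := by
      apply mul_nonneg (by positivity); linarith
    nlinarith
  linarith

end ParallelQR

theorem mainTheorem1 (m n P W : ℕ) (hn : Even n) (hn0 : 0 < n) (hmn : n ≤ m) (hP : 0 < P)
    (alg : ParallelQR.Algorithm m n P W) (halg : alg.IsQRAlgorithm)
    (A : Matrix (Fin m) (Fin n) ℝ) (hA : A.rank = n) :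
    ∃ p : Fin P,
      -- the general bounds
      (((m : ℝ) * n ^ 2 / 4 - (n : ℝ) ^ 2 / 8 * ((n : ℝ) / 2 + 1)) / (P * √(8 * (W : ℝ))) - W
          ≤ ((alg.run A).words p : ℝ) ∧
        3 * (n : ℝ) ^ 2 * ((m : ℝ) - 4 / 3) / (16 * P * √(8 * (W : ℝ))) - W
          ≤ ((m : ℝ) * n ^ 2 / 4 - (n : ℝ) ^ 2 / 8 * ((n : ℝ) / 2 + 1)) / (P * √(8 * (W : ℝ))) - W ∧
        ((m : ℝ) * n ^ 2 / 4 - (n : ℝ) ^ 2 / 8 * ((n : ℝ) / 2 + 1)) / (P * √(8 * (W : ℝ) ^ 3)) - 1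
          ≤ ((alg.run A).messages p : ℝ) ∧
        3 * (n : ℝ) ^ 2 * ((m : ℝ) - 4 / 3) / (16 * P * √(8 * (W : ℝ) ^ 3)) - 1
          ≤ ((m : ℝ) * n ^ 2 / 4 - (n : ℝ) ^ 2 / 8 * ((n : ℝ) / 2 + 1)) / (P * √(8 * (W : ℝ) ^ 3))
            - 1) ∧
      -- memory `m n / P` and a matrix that is not too rectangular
      ((W : ℝ) = (m : ℝ) * n / P → (2 : ℝ) ^ 11 * m / P ≤ n →
        √((m : ℝ) * n ^ 3 / (2 ^ 11 * P)) ≤ ((alg.run A).words p : ℝ) ∧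
        √((n : ℝ) * P / (2 ^ 11 * m)) ≤ ((alg.run A).messages p : ℝ)) ∧
      -- the square case
      (m = n → (W : ℝ) = (m : ℝ) * n / P → 2 ^ 11 ≤ P →
        (n : ℝ) ^ 2 / ((2 : ℝ) ^ (11 / 2 : ℝ) * (P : ℝ) ^ (1 / 2 : ℝ))
          ≤ ((alg.run A).words p : ℝ) ∧
        √((P : ℝ) / 2 ^ 11) ≤ ((alg.run A).messages p : ℝ)) := by
  obtain ⟨p, hp⟩ := halg.exists_card_mulsIn_ge hn hmn hP hA
  have hW : 0 < W := by
    obtain ⟨_, c, _⟩ := halg.input ⟨0, hn0.trans_le hmn⟩ ⟨0, hn0⟩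
    exact c.pos
  have hn' : (0 : ℝ) < n := by exact_mod_cast hn0
  have hP' : (0 : ℝ) < P := by exact_mod_cast hP
  have hW' : (0 : ℝ) < W := by exact_mod_cast hW
  have hmn' : (n : ℝ) ≤ m := by exact_mod_cast hmn
  have hm' : (0 : ℝ) < m := hn'.trans_le hmn'
  have hD : 0 < √(8 * (W : ℝ)) := Real.sqrt_pos.2 (by positivity)
  have hD3 : √(8 * (W : ℝ) ^ 3) = √(8 * (W : ℝ)) * W := by
    rw [show 8 * (W : ℝ) ^ 3 = 8 * W * W ^ 2 by ring, Real.sqrt_mul (by positivity),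
      Real.sqrt_sq hW'.le]
  have hwords : ((m : ℝ) * n ^ 2 / 4 - (n : ℝ) ^ 2 / 8 * ((n : ℝ) / 2 + 1)) / (P * √(8 * (W : ℝ)))
      - W ≤ ((alg.run A).words p : ℝ) := by
    rw [sub_le_iff_le_add, div_le_iff₀ (by positivity)]
    refine hp.trans ((mul_le_mul_of_nonneg_left
      (ParallelQR.Execution.card_mulsIn_le_words (halg.kept A hA) p) hP'.le).trans (le_of_eq ?_))
    ring
  have hmess : ((alg.run A).words p : ℝ) ≤ (alg.run A).messages p * W := by
    rw [mul_comm]; exact_mod_cast (alg.run A).words_le_mul_messages p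
  have hcount : 3 * (n : ℝ) ^ 2 * ((m : ℝ) - 4 / 3) / 16 ≤
      (m : ℝ) * n ^ 2 / 4 - (n : ℝ) ^ 2 / 8 * ((n : ℝ) / 2 + 1) := by
    have : 0 ≤ (n : ℝ) ^ 2 * ((m - n) / 16 + 1 / 8) := by
      apply mul_nonneg (by positivity); linarith
    linarith
  have hcount' : ∀ d : ℝ, 0 < d → 3 * (n : ℝ) ^ 2 * ((m : ℝ) - 4 / 3) / (16 * P * d) ≤
      ((m : ℝ) * n ^ 2 / 4 - (n : ℝ) ^ 2 / 8 * ((n : ℝ) / 2 + 1)) / (P * d) := by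
    intro d hd
    rw [mul_assoc 16, ← div_div]
    exact div_le_div_of_nonneg_right hcount (by positivity)
  have hrect : (W : ℝ) = (m : ℝ) * n / P → (2 : ℝ) ^ 11 * m / P ≤ n →
      √((m : ℝ) * n ^ 3 / (2 ^ 11 * P)) ≤ ((alg.run A).words p : ℝ) ∧
      √((n : ℝ) * P / (2 ^ 11 * m)) ≤ ((alg.run A).messages p : ℝ) := by
    intro hWeq hnP
    obtain ⟨h1, h2⟩ := ParallelQR.sqrt_le_of_memory_eq hn0 hmn hP hW hWeq hnP hwords
    exact ⟨h1, le_of_mul_le_mul_right (h2.trans hmess) hW'⟩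
  refine ⟨p, ⟨hwords, sub_le_sub_right (hcount' _ hD) _, ?_, sub_le_sub_right (hcount' _ ?_) _⟩,
    hrect, ?_⟩
  · refine le_of_mul_le_mul_right (le_trans (le_of_eq ?_) (hwords.trans hmess)) hW'
    rw [hD3]
    field_simp
  · rw [hD3]; positivity
  · intro hmn_eq hWeq hP11
    have hP11' : (2 : ℝ) ^ 11 ≤ P := by exact_mod_cast hP11
    have hmn_eq' : (m : ℝ) = n := by exact_mod_cast hmn_eq
    obtain ⟨h1, h2⟩ := hrect hWeq (by rw [div_le_iff₀ hP', hmn_eq']; nlinarith)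
    rw [hmn_eq'] at h1 h2
    constructor
    · refine le_trans (le_of_eq ?_) h1
      have h3 : (2 : ℝ) ^ (11 / 2 : ℝ) = √(2 ^ 11) := by
        rw [Real.sqrt_eq_rpow, ← Real.rpow_natCast, ← Real.rpow_mul (by norm_num)]
        norm_num
      rw [h3, ← Real.sqrt_eq_rpow, ← Real.sqrt_mul (by positivity),
        show (n : ℝ) * n ^ 3 = (n ^ 2) ^ 2 by ring, Real.sqrt_div (by positivity),
        Real.sqrt_sq (by positivity)]
    · refine le_trans (le_of_eq ?_) h2
      congr 1
      field_simp
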